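/- Let $R$ be a Cohen–Macaulay (Noetherian, commutative) local ring possessing a canonical module $\omega_R$, and let $M$ and $N$ be finitely generated $R$-modules with $N$ maximal Cohen–Macaulay, i.e. $\operatorname{depth} N=\dim R$ (with the convention $\operatorname{depth} 0=+\infty$, so that $0$ is not maximal Cohen–Macaulay). Put $N^{\vee}=\operatorname{Hom}_R(N,\omega_R)$, and let $\Omega_1^R M$ be the first syzygy module of $M$, i.e. the image of the first differential $F_1\to F_0$ in a minimal free resolution $\cdots\to F_1\to F_0\to M\to 0$ of $M$. Suppose that $$\operatorname{depth}\bigl(\Omega_1^R M\otimes_R N^{\vee}\bigr)\neq \operatorname{depth}\bigl(M\otimes_R N^{\vee}\bigr)+1$$ (this holds, for example, if $M\otimes_R N^{\vee}$ is maximal Cohen–Macaulay). If $\operatorname{pd}_R M<\infty$, then $M$ is free. -/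

import Mathlib

open CategoryTheory IsLocalRing
open scoped TensorProduct

universe u

/-- The depth of a module `M` over a local ring `R`: the supremum of the lengths of the
`M`-regular sequences contained in the maximal ideal. For a nonzero finite module every weakly
regular sequence in the maximal ideal is regular, by Nakayama's lemma; for the zero module every
sequence is weakly regular, so that its depth is `⊤`. -/
noncomputable def moduleDepth (R : Type u) [CommRing R] [IsLocalRing R]
    (M : Type u) [AddCommGroup M] [Module R M] : ℕ∞ :=
  ⨆ (rs : List R) (_ : (∀ r ∈ rs, r ∈ maximalIdeal R) ∧
    RingTheory.Sequence.IsWeaklyRegular M rs), (rs.length : ℕ∞)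

/-- A finite module over a local ring is maximal Cohen-Macaulay if its depth is the Krull
dimension of the ring. The zero module has infinite depth, hence is not maximal Cohen-Macaulay
over a Noetherian local ring. -/
structure IsMaximalCohenMacaulay (R : Type u) [CommRing R] [IsLocalRing R]
    (M : Type u) [AddCommGroup M] [Module R M] : Prop where
  finite : Module.Finite R M
  depth_eq : (moduleDepth R M : WithBot ℕ∞) = ringKrullDim R

/-- A Cohen-Macaulay local ring: a Noetherian local ring whose depth is its Krull dimension. -/
class IsCohenMacaulayLocalRing (R : Type u) [CommRing R] : Prop
    extends IsLocalRing R, IsNoetherianRing R where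
  depth_eq : (moduleDepth R R : WithBot ℕ∞) = ringKrullDim R

/-- The type of a finite nonzero module `M` of depth `t` over a Noetherian local ring with
residue field `k`: the `k`-dimension of `Ext^t(k, M)`. Since this module is annihilated by the
maximal ideal, its `k`-dimension is its length over `R`. -/
noncomputable def moduleType (R : Type u) [CommRing R] [IsLocalRing R]
    (M : Type u) [AddCommGroup M] [Module R M] : ℕ∞ :=
  Module.length R (Abelian.Ext (ModuleCat.of R (ResidueField R)) (ModuleCat.of R M)
    (moduleDepth R M).toNat)

/-- A canonical module of a Cohen-Macaulay local ring: a maximal Cohen-Macaulay module of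
type one and of finite injective dimension. -/
structure IsCanonicalModule (R : Type u) [CommRing R] [IsLocalRing R]
    (C : Type u) [AddCommGroup C] [Module R C] : Prop where
  isMaximalCohenMacaulay : IsMaximalCohenMacaulay R C
  type_eq_one : moduleType R C = 1
  injectiveDimension_lt_top : injectiveDimension (ModuleCat.of R C) < ⊤

/-- A minimal free resolution `⋯ → R^(rank 2) → R^(rank 1) → R^(rank 0) → M → 0` of a module
over a local ring, by free modules of finite rank. -/
structure MinimalFreeResolution (R : Type u) [CommRing R] [IsLocalRing R]
    (M : Type u) [AddCommGroup M] [Module R M] where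
  rank : ℕ → ℕ
  d : ∀ i, (Fin (rank (i + 1)) → R) →ₗ[R] (Fin (rank i) → R)
  ε : (Fin (rank 0) → R) →ₗ[R] M
  ε_surjective : Function.Surjective ε
  exact_zero : Function.Exact (d 0) ε
  exact_succ : ∀ i, Function.Exact (d (i + 1)) (d i)
  minimal : ∀ i, LinearMap.range (d i) ≤ maximalIdeal R • ⊤

/-- The first syzygy module `Ω₁ M`: the image of the first differential `R^(rank 1) → R^(rank 0)`
of a minimal free resolution of `M`. -/
abbrev MinimalFreeResolution.firstSyzygy {R : Type u} [CommRing R] [IsLocalRing R]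
    {M : Type u} [AddCommGroup M] [Module R M] (F : MinimalFreeResolution R M) :
    Submodule R (Fin (F.rank 0) → R) :=
  LinearMap.range (F.d 0)

/-- The dual `Hom_R(N, ω)` of `N` with respect to `ω`; the canonical dual when `ω` is a canonical
module. -/
abbrev CanonicalDual (R : Type u) [CommRing R] (ω : Type u) [AddCommGroup ω] [Module R ω]
    (N : Type u) [AddCommGroup N] [Module R N] : Type u :=
  N →ₗ[R] ω

/-! Write d = dim R, X = N^∨ and Ω = Ω₁M. By Bass' theorem ω has injective dimension at most d, so
Ext^i(N, ω) = 0 for i > 0 as N is maximal Cohen–Macaulay; dualizing a free presentation of N then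
gives depth X ≥ d (`DepthGE.linearMap`).

Next, Tor₁(M, X) = 0 when pd M < ∞ (`rTensor_injective_of_hasProjectiveDimensionLE`). This Tor is
killed by some x outside every minimal prime, because M is free at the minimal primes. Such an x is
regular on R and X, and induction on d, through R/x, shows that it is regular on Ω ⊗ X, which
contains the Tor. Hence 0 → Ω ⊗ X → F₀ ⊗ X → M ⊗ X → 0 is exact, with middle term of depth at least
d.

If depth(M ⊗ X) < d, the depth lemma gives depth(Ω ⊗ X) = depth(M ⊗ X) + 1, which is excluded. If
depth(M ⊗ X) ≥ d and X ≠ 0, induction on pd M reduces to free Ω, and comparing Ext^d(k, -) along the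
sequence, k the residue field, forces Ω → F₀ to split (`exists_retraction_of_depthGE`), so M is
free. -/

open scoped Pointwise

/-! ### Vanishing of Ext along short exact sequences. -/

section ExtSequences

open Abelian

variable {R : Type u} [CommRing R] {A B C : Type u} [AddCommGroup A] [AddCommGroup B]
  [AddCommGroup C] [Module R A] [Module R B] [Module R C]

/-- The short complex of modules attached to an exact pair of linear maps. -/
abbrev Function.Exact.moduleCatComplex {f : A →ₗ[R] B} {g : B →ₗ[R] C}
    (h : Function.Exact f g) : ShortComplex (ModuleCat.{u} R) :=
  ModuleCat.shortComplexOfCompEqZero f g h.linearMap_comp_eq_zero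

lemma Function.Exact.moduleCatComplex_shortExact {f : A →ₗ[R] B} {g : B →ₗ[R] C}
    (h : Function.Exact f g) (hf : Function.Injective f) (hg : Function.Surjective g) :
    h.moduleCatComplex.ShortExact :=
  ModuleCat.shortComplex_shortExact _ h hf hg

variable {f : A →ₗ[R] B} {g : B →ₗ[R] C} (hf : Function.Injective f) (h : Function.Exact f g)
  (hg : Function.Surjective g)
include hf h hg

lemma subsingleton_ext_left_term (L : ModuleCat.{u} R) (n : ℕ)
    (hC : Subsingleton (Ext L (ModuleCat.of R C) n))
    (hB : Subsingleton (Ext L (ModuleCat.of R B) (n + 1))) :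
    Subsingleton (Ext L (ModuleCat.of R A) (n + 1)) := by
  refine subsingleton_of_forall_eq 0 fun a ↦ ?_
  obtain ⟨c, rfl⟩ := Ext.covariant_sequence_exact₁ L (h.moduleCatComplex_shortExact hf hg)
    (n₀ := n) a (Subsingleton.elim (α := Ext L (ModuleCat.of R B) (n + 1)) _ _) rfl
  rw [Subsingleton.elim (α := Ext L (ModuleCat.of R C) n) c 0, Ext.zero_comp]

lemma subsingleton_ext_right_term (L : ModuleCat.{u} R) (n : ℕ)
    (hB : Subsingleton (Ext L (ModuleCat.of R B) n))
    (hA : Subsingleton (Ext L (ModuleCat.of R A) (n + 1))) :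
    Subsingleton (Ext L (ModuleCat.of R C) n) := by
  refine subsingleton_of_forall_eq 0 fun c ↦ ?_
  obtain ⟨b, rfl⟩ := Ext.covariant_sequence_exact₃ L (h.moduleCatComplex_shortExact hf hg)
    (n₁ := n + 1) c rfl (Subsingleton.elim (α := Ext L (ModuleCat.of R A) (n + 1)) _ _)
  rw [Subsingleton.elim (α := Ext L (ModuleCat.of R B) n) b 0, Ext.zero_comp]

lemma subsingleton_ext_from_right_term (Y : ModuleCat.{u} R) (n : ℕ)
    (hA : Subsingleton (Ext (ModuleCat.of R A) Y n))
    (hB : Subsingleton (Ext (ModuleCat.of R B) Y (n + 1))) :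
    Subsingleton (Ext (ModuleCat.of R C) Y (n + 1)) := by
  refine subsingleton_of_forall_eq 0 fun c ↦ ?_
  obtain ⟨a, rfl⟩ := Ext.contravariant_sequence_exact₃ (h.moduleCatComplex_shortExact hf hg) Y
    (n₀ := n) c (Subsingleton.elim (α := Ext (ModuleCat.of R B) Y (n + 1)) _ _) (add_comm 1 n)
  rw [Subsingleton.elim (α := Ext (ModuleCat.of R A) Y n) a 0, Ext.comp_zero]

lemma subsingleton_ext_from_left_term (Y : ModuleCat.{u} R) (n : ℕ)
    (hB : Subsingleton (Ext (ModuleCat.of R B) Y n))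
    (hC : Subsingleton (Ext (ModuleCat.of R C) Y (n + 1))) :
    Subsingleton (Ext (ModuleCat.of R A) Y n) := by
  refine subsingleton_of_forall_eq 0 fun a ↦ ?_
  obtain ⟨b, rfl⟩ := Ext.contravariant_sequence_exact₁ (h.moduleCatComplex_shortExact hf hg) Y
    (n₁ := n + 1) a (add_comm 1 n)
    (Subsingleton.elim (α := Ext (ModuleCat.of R C) Y (n + 1)) _ _)
  rw [Subsingleton.elim (α := Ext (ModuleCat.of R B) Y n) b 0, Ext.comp_zero]

lemma subsingleton_ext_from_middle_term (Y : ModuleCat.{u} R) (n : ℕ)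
    (hA : Subsingleton (Ext (ModuleCat.of R A) Y n))
    (hC : Subsingleton (Ext (ModuleCat.of R C) Y n)) :
    Subsingleton (Ext (ModuleCat.of R B) Y n) := by
  refine subsingleton_of_forall_eq 0 fun b ↦ ?_
  obtain ⟨c, rfl⟩ := Ext.contravariant_sequence_exact₂ (h.moduleCatComplex_shortExact hf hg) Y
    b (Subsingleton.elim (α := Ext (ModuleCat.of R A) Y n) _ _)
  rw [Subsingleton.elim (α := Ext (ModuleCat.of R C) Y n) c 0, Ext.comp_zero]

end ExtSequences

/-! ### Ext under isomorphisms and modulo a regular element. -/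

section ExtLinearEquiv

open Abelian

variable {R : Type u} [CommRing R]

lemma subsingleton_ext_from_linearEquiv {A B : Type u} [AddCommGroup A] [AddCommGroup B]
    [Module R A] [Module R B] (e : A ≃ₗ[R] B) (Y : ModuleCat.{u} R) (n : ℕ)
    (h : Subsingleton (Ext (ModuleCat.of R A) Y n)) :
    Subsingleton (Ext (ModuleCat.of R B) Y n) := by
  refine subsingleton_of_forall_eq 0 fun b ↦ ?_
  rw [← Ext.mk₀_id_comp b, ← e.toModuleIso.inv_hom_id, ← Ext.mk₀_comp_mk₀,
    Ext.comp_assoc_of_second_deg_zero,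
    Subsingleton.elim ((Ext.mk₀ e.toModuleIso.hom).comp b (zero_add n)) 0, Ext.comp_zero]

/-- If `Ext^(n+1)(L/xL, Y)` vanishes for an `L`-regular element `x` of the maximal ideal, then
so does `Ext^n(L, Y)`, by Nakayama's lemma. -/
lemma subsingleton_ext_of_quotSMulTop [IsLocalRing R] [IsNoetherianRing R]
    (L Y : Type u) [AddCommGroup L] [Module R L] [Module.Finite R L] [AddCommGroup Y] [Module R Y]
    [Module.Finite R Y] {x : R} (hx : x ∈ maximalIdeal R) (reg : IsSMulRegular L x) (n : ℕ)
    (h : Subsingleton (Ext (ModuleCat.of R (QuotSMulTop x L)) (ModuleCat.of R Y) (n + 1))) :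
    Subsingleton (Ext (ModuleCat.of R L) (ModuleCat.of R Y) n) := by
  have hS : ((ModuleCat.of R L).smulShortComplex x).ShortExact :=
    IsSMulRegular.smulShortComplex_shortExact reg
  by_contra! ntr
  have hj : x ∈ (Module.annihilator R (Ext (ModuleCat.of R L) (ModuleCat.of R Y) n)).jacobson :=
    maximalIdeal_le_jacobson _ hx
  refine Submodule.top_ne_pointwise_smul_of_mem_jacobson_annihilator hj ?_
  rw [eq_comm, eq_top_iff]
  intro y _
  -- Since the next Ext vanishes, multiplication by x is surjective on this finite module.
  obtain ⟨z, hz⟩ : ∃ z : Ext (ModuleCat.of R L) (ModuleCat.of R Y) n,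
      (Ext.mk₀ (x • 𝟙 (ModuleCat.of R L))).comp z (zero_add n) = y :=
    Ext.contravariant_sequence_exact₁ hS (ModuleCat.of R Y) (n₁ := n + 1) y
      (add_comm 1 n) (Subsingleton.elim (α := Ext (ModuleCat.of R (QuotSMulTop x L))
        (ModuleCat.of R Y) (n + 1)) _ _)
  rw [Ext.mk₀_smul, Ext.smul_comp, Ext.mk₀_id_comp] at hz
  rw [← hz]
  exact Submodule.smul_mem_pointwise_smul _ _ ⊤ trivial

end ExtLinearEquiv

/-! ### Depth: Rees' criterion, the depth lemma and associated primes. -/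

section Depth

open Abelian RingTheory.Sequence

/-- The module `M` has a weakly regular sequence of length `n` in the maximal ideal. -/
def DepthGE (R : Type u) [CommRing R] [IsLocalRing R] (n : ℕ)
    (M : Type u) [AddCommGroup M] [Module R M] : Prop :=
  ∃ rs : List R, rs.length = n ∧ (∀ r ∈ rs, r ∈ maximalIdeal R) ∧ IsWeaklyRegular M rs

variable {R : Type u} [CommRing R] [IsLocalRing R]
  {M : Type u} [AddCommGroup M] [Module R M]

lemma DepthGE.mono {m n : ℕ} (h : DepthGE R n M) (hmn : m ≤ n) : DepthGE R m M := by
  obtain ⟨rs, rfl, hm, hr⟩ := h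
  refine ⟨rs.take m, by simpa using hmn, fun r hr ↦ hm r (List.mem_of_mem_take hr), ?_⟩
  rw [← List.take_append_drop m rs, isWeaklyRegular_append_iff] at hr
  exact hr.1

/-- Weakly regular sequences can be truncated, so a natural number below the supremum is itself the
length of one. -/
lemma natCast_le_moduleDepth_iff {n : ℕ} : (n : ℕ∞) ≤ moduleDepth R M ↔ DepthGE R n M := by
  constructor
  · intro h
    by_contra hn
    cases n with
    | zero => exact hn ⟨[], rfl, by simp, .nil R M⟩
    | succ n =>
      have : moduleDepth R M ≤ n := by
        refine iSup₂_le fun rs hrs ↦ ?_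
        by_contra! hlt
        exact hn (DepthGE.mono ⟨rs, rfl, hrs⟩ (by exact_mod_cast Order.add_one_le_of_lt hlt))
      have h2 := h.trans this
      norm_cast at h2
      omega
  · rintro ⟨rs, rfl, h⟩
    exact le_iSup₂_of_le rs h le_rfl

lemma depthGE_of_subsingleton [Subsingleton M] (n : ℕ) : DepthGE R n M := by
  refine ⟨List.replicate n 0, by simp, fun r hr ↦ ?_, ?_⟩
  · rw [List.eq_of_mem_replicate hr]; exact zero_mem _
  · rw [isWeaklyRegular_iff_Fin]
    intro i
    exact fun a b _ ↦ Subsingleton.elim _ _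

lemma moduleDepth_of_subsingleton [Subsingleton M] : moduleDepth R M = ⊤ :=
  ENat.eq_top_iff_forall_ge.mpr fun n ↦ natCast_le_moduleDepth_iff.mpr (depthGE_of_subsingleton n)

lemma DepthGE.of_linearEquiv {M' : Type u} [AddCommGroup M'] [Module R M'] {n : ℕ}
    (h : DepthGE R n M) (e : M ≃ₗ[R] M') : DepthGE R n M' := by
  obtain ⟨rs, hl, hm, hr⟩ := h
  exact ⟨rs, hl, hm, (e.isWeaklyRegular_congr rs).mp hr⟩

lemma DepthGE.tensor_left {n : ℕ} (h : DepthGE R n M) (F : Type u) [AddCommGroup F] [Module R F]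
    [Module.Flat R F] : DepthGE R n (F ⊗[R] M) := by
  obtain ⟨rs, hl, hm, hr⟩ := h
  exact ⟨rs, hl, hm, hr.isWeaklyRegular_lTensor⟩

variable [IsNoetherianRing R]

/-- Rees' criterion, which makes depth accessible to long exact sequences. The zero module satisfies
both sides for every n. -/
lemma depthGE_iff_subsingleton_ext [Module.Finite R M] {n : ℕ} :
    DepthGE R n M ↔ ∀ i < n, Subsingleton
      (Ext (ModuleCat.of R (ResidueField R)) (ModuleCat.of R M) i) := by
  rcases subsingleton_or_nontrivial M with hM | hM
  · refine iff_of_true (depthGE_of_subsingleton n) fun i _ ↦ ?_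
    refine subsingleton_of_forall_eq 0 fun e ↦ ?_
    have : Limits.IsZero (ModuleCat.of R M) := ModuleCat.isZero_of_subsingleton _
    rw [← e.comp_mk₀_id, this.eq_of_src (𝟙 _) 0, Ext.mk₀_zero, Ext.comp_zero]
  · have hlt : maximalIdeal R • (⊤ : Submodule R (ModuleCat.of R M)) < ⊤ :=
      lt_top_iff_ne_top.mpr (Submodule.top_ne_ideal_smul_of_le_jacobson_annihilator
        (maximalIdeal_le_jacobson _)).symm
    have hsupp : Module.support R (ModuleCat.of R (ResidueField R)) =
        PrimeSpectrum.zeroLocus (maximalIdeal R) := by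
      change Module.support R (R ⧸ maximalIdeal R) = _
      rw [Module.support_eq_zeroLocus, Ideal.annihilator_quotient]
    have hfin : Module.Finite R (ModuleCat.of R (ResidueField R)) :=
      inferInstanceAs (Module.Finite R (ResidueField R))
    have hnt : Nontrivial (ModuleCat.of R (ResidueField R)) :=
      inferInstanceAs (Nontrivial (ResidueField R))
    have T := ModuleCat.exists_isRegular_tfae (maximalIdeal R) n (ModuleCat.of R M) hlt
    have T14 := T.out 0 3
    have T34 := T.out 2 3
    constructor
    · rintro ⟨rs, hl, hm, hr⟩
      exact T14.mpr ⟨rs, hl, hm, .of_isWeaklyRegular_of_mem_maximalIdeal _ hm hr⟩ _ hnt hfin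
        hsupp.subset
    · intro h
      obtain ⟨rs, hl, hm, hr⟩ := T34.mp ⟨_, hnt, hfin, hsupp, h⟩
      exact ⟨rs, hl, hm, hr.toIsWeaklyRegular⟩

section ShortExact

variable {A B C : Type u} [AddCommGroup A] [AddCommGroup B] [AddCommGroup C] [Module R A]
  [Module R B] [Module R C] [Module.Finite R A] [Module.Finite R B] [Module.Finite R C]
  {f : A →ₗ[R] B} {g : B →ₗ[R] C} (hf : Function.Injective f) (h : Function.Exact f g)
  (hg : Function.Surjective g)
include hf h hg

lemma DepthGE.left_term {n : ℕ} (hB : DepthGE R (n + 1) B) (hC : DepthGE R n C) :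
    DepthGE R (n + 1) A := by
  rw [depthGE_iff_subsingleton_ext] at *
  rintro (_ | i) hi
  · have := hB 0 hi
    refine subsingleton_of_forall_eq 0 fun e ↦ ?_
    have : Mono h.moduleCatComplex.f := (ModuleCat.mono_iff_injective _).mpr hf
    exact Ext.postcomp_mk₀_injective_of_mono _ h.moduleCatComplex.f
      (Subsingleton.elim (α := Ext (ModuleCat.of R (ResidueField R)) (ModuleCat.of R B) 0) _ _)
  · exact subsingleton_ext_left_term hf h hg _ i (hC i (by omega)) (hB (i + 1) hi)

lemma DepthGE.right_term {n : ℕ} (hB : DepthGE R n B) (hA : DepthGE R (n + 1) A) :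
    DepthGE R n C := by
  rw [depthGE_iff_subsingleton_ext] at *
  intro i hi
  exact subsingleton_ext_right_term hf h hg _ i (hB i hi) (hA (i + 1) (by omega))

end ShortExact

lemma DepthGE.quotSMulTop [Module.Finite R M] {n : ℕ} (h : DepthGE R (n + 1) M) {x : R}
    (hx : IsSMulRegular M x) : DepthGE R n (QuotSMulTop x M) :=
  DepthGE.right_term (f := LinearMap.lsmul R M x) (g := (x • (⊤ : Submodule R M)).mkQ) hx
    (LinearMap.exact_lsmul_mkQ_smul_top M x) (Submodule.mkQ_surjective _) (h.mono (by omega)) h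

/-- The dimension of `R/P` bounds the depth of `M` for every associated prime `P` of `M`. -/
lemma DepthGE.le_ringKrullDim_quotient {n : ℕ} (M : Type u) [AddCommGroup M] [Module R M]
    [Module.Finite R M] (h : DepthGE R n M) {P : Ideal R} (hP : P ∈ associatedPrimes R M) :
    (n : WithBot ℕ∞) ≤ ringKrullDim (R ⧸ P) := by
  induction n generalizing M P with
  | zero =>
    have : P.IsPrime := hP.isPrime
    exact_mod_cast ringKrullDim_nonneg_of_nontrivial
  | succ n ih =>
    obtain ⟨rs, hl, hm, hr⟩ := h
    obtain ⟨x, rs, rfl⟩ := List.exists_cons_of_length_eq_add_one hl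
    have hxm := hm x (by simp)
    rw [isWeaklyRegular_cons_iff] at hr
    have hPp : P.IsPrime := hP.isPrime
    obtain ⟨-, u, hu⟩ := isAssociatedPrime_iff.mp hP
    have hxP : x ∉ P := fun hx ↦ by
      rw [hu, Submodule.mem_colon_singleton, Submodule.mem_bot] at hx
      have hu0 : u = 0 := hr.1 (by simpa using hx)
      exact hPp.ne_top (by rw [hu, hu0]; simp)
    -- Let U be the submodule killed by P. If U lay in xM, regularity of x would give U = xU, hence
    -- U = 0 by Nakayama, although u is a nonzero element of U.
    obtain ⟨v, hPv, hv⟩ : ∃ v : M, (∀ p ∈ P, p • v = 0) ∧ v ∉ x • (⊤ : Submodule R M) := by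
      by_contra! hcon
      let U : Submodule R M := Submodule.torsionBySet R M P
      have hU : U ≤ maximalIdeal R • U := by
        intro v hv
        rw [Submodule.mem_torsionBySet_iff] at hv
        obtain ⟨w, -, hw⟩ := (Submodule.mem_smul_pointwise_iff_exists _ _ _).mp
          (hcon v fun p hp ↦ hv ⟨p, hp⟩)
        rw [← hw]
        refine Submodule.smul_mem_smul hxm ?_
        rw [Submodule.mem_torsionBySet_iff]
        intro p
        refine hr.1 ?_
        have := hv p
        rw [← hw] at this
        simp only [smul_zero]
        rw [smul_comm]; exact this
      have hbot : U = ⊥ := Submodule.eq_bot_of_le_smul_of_le_jacobson_bot _ _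
        (IsNoetherian.noetherian U) hU (maximalIdeal_le_jacobson _)
      have huU : u ∈ U := by
        rw [Submodule.mem_torsionBySet_iff]
        rintro ⟨p, hp⟩
        rw [SetLike.mem_coe, hu, Submodule.mem_colon_singleton, Submodule.mem_bot] at hp
        exact hp
      rw [hbot, Submodule.mem_bot] at huU
      exact hPp.ne_top (by rw [hu, huU]; simp)
    -- An associated prime Q of M/xM over the annihilator of the class of v contains P and x, so it
    -- is strictly larger than P and the dimension of the quotient drops.
    obtain ⟨Q, hQ, hle⟩ := exists_le_isAssociatedPrime_of_isNoetherianRing R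
      (Submodule.Quotient.mk v : QuotSMulTop x M)
      (by rwa [Ne, Submodule.Quotient.mk_eq_zero])
    have hPQ : P ≤ Q := fun p hp ↦ hle (by
      rw [Submodule.mem_colon_singleton, Submodule.mem_bot, ← Submodule.Quotient.mk_smul,
        hPv p hp, Submodule.Quotient.mk_zero])
    have hxQ : x ∈ Q := hle (by
      rw [Submodule.mem_colon_singleton, Submodule.mem_bot, ← Submodule.Quotient.mk_smul,
        Submodule.Quotient.mk_eq_zero]
      exact Submodule.smul_mem_pointwise_smul _ _ _ trivial)
    have hstep := ringKrullDim_succ_le_of_surjective (Ideal.Quotient.factor hPQ)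
      (Ideal.Quotient.factor_surjective hPQ) (r := Ideal.Quotient.mk P x)
      (mem_nonZeroDivisors_of_ne_zero (by rwa [Ne, Ideal.Quotient.eq_zero_iff_mem]))
      (by rw [Ideal.Quotient.factor_mk, Ideal.Quotient.eq_zero_iff_mem]; exact hxQ)
    have hn := ih (QuotSMulTop x M) ⟨rs, by simpa using hl, fun r hr ↦ hm r (by simp [hr]), hr.2⟩ hQ
    refine le_trans ?_ hstep
    push_cast
    gcongr

lemma DepthGE.le_ringKrullDim {n : ℕ} (M : Type u) [AddCommGroup M] [Module R M]
    [Module.Finite R M] [Nontrivial M] (h : DepthGE R n M) : (n : WithBot ℕ∞) ≤ ringKrullDim R := by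
  obtain ⟨P, hP⟩ := associatedPrimes.nonempty R M
  exact (h.le_ringKrullDim_quotient M hP).trans (ringKrullDim_quotient_le P)

/-- The associated primes of a module whose depth is the dimension of the ring are minimal. -/
lemma DepthGE.associatedPrimes_subset_minimalPrimes {d : ℕ} (hd : ringKrullDim R = d) (M : Type u)
    [AddCommGroup M] [Module R M] [Module.Finite R M] (h : DepthGE R d M) :
    associatedPrimes R M ⊆ minimalPrimes R := by
  intro P hP
  have hPp : P.IsPrime := hP.isPrime
  refine ⟨⟨hPp, bot_le⟩, fun Q ⟨hQ, _⟩ hQP ↦ ?_⟩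
  by_contra hPQ
  obtain ⟨x, hxP, hxQ⟩ := Set.not_subset.mp hPQ
  -- A prime Q strictly inside P would have dim R/Q ≥ dim R/P + 1 ≥ d + 1.
  have hstep := ringKrullDim_succ_le_of_surjective (Ideal.Quotient.factor hQP)
    (Ideal.Quotient.factor_surjective hQP) (r := Ideal.Quotient.mk Q x)
    (mem_nonZeroDivisors_of_ne_zero (by rwa [Ne, Ideal.Quotient.eq_zero_iff_mem]))
    (by rw [Ideal.Quotient.factor_mk, Ideal.Quotient.eq_zero_iff_mem]; exact hxP)
  have h1 := h.le_ringKrullDim_quotient M hP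
  have h2 := hstep.trans ((ringKrullDim_quotient_le Q).trans hd.le)
  have h3 : ((d + 1 : ℕ) : WithBot ℕ∞) ≤ d := le_trans (by push_cast; gcongr) h2
  have h4 : d + 1 ≤ d := by exact_mod_cast h3
  omega

end Depth

/-! ### Projective dimension, syzygies and splittings. -/

section ProjectiveDimension

variable {R : Type u} [CommRing R] {K F M : Type u} [AddCommGroup K] [AddCommGroup F]
  [AddCommGroup M] [Module R K] [Module R F] [Module R M]

lemma hasProjectiveDimensionLE_zero_iff :
    HasProjectiveDimensionLE (ModuleCat.of R M) 0 ↔ Module.Projective R M := by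
  rw [← projective_iff_hasProjectiveDimensionLE_zero, ← IsProjective.iff_projective]

lemma hasProjectiveDimensionLE_succ_iff {f : K →ₗ[R] F} {g : F →ₗ[R] M}
    (hf : Function.Injective f) (h : Function.Exact f g) (hg : Function.Surjective g)
    [Module.Projective R F] (n : ℕ) :
    HasProjectiveDimensionLE (ModuleCat.of R M) (n + 1) ↔
      HasProjectiveDimensionLE (ModuleCat.of R K) n :=
  (h.moduleCatComplex_shortExact hf hg).hasProjectiveDimensionLT_X₃_iff n
    ((IsProjective.iff_projective F).mp inferInstance)

lemma Function.Exact.projective_of_retraction {f : K →ₗ[R] F} {g : F →ₗ[R] M}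
    (h : Function.Exact f g) (hf : Function.Injective f) (hg : Function.Surjective g)
    [Module.Projective R F] (hr : ∃ l, l ∘ₗ f = LinearMap.id) : Module.Projective R M := by
  obtain ⟨s, hs⟩ := ((h.split_tfae hf hg).out 1 0).mp hr
  exact Module.Projective.of_split s g hs

lemma Function.Exact.exists_retraction_of_projective {f : K →ₗ[R] F} {g : F →ₗ[R] M}
    (h : Function.Exact f g) (hf : Function.Injective f) (hg : Function.Surjective g)
    [Module.Projective R M] : ∃ l, l ∘ₗ f = LinearMap.id :=
  ((h.split_tfae hf hg).out 0 1).mp (Module.projective_lifting_property g LinearMap.id hg)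

/-- Any finite module over a Noetherian ring has a presentation by a finite free module. -/
lemma exists_exact_finite_free (R M : Type u) [CommRing R] [AddCommGroup M] [Module R M]
    [Module.Finite R M] :
    ∃ (n : ℕ) (g : (Fin n → R) →ₗ[R] M), Function.Injective (LinearMap.ker g).subtype ∧
      Function.Exact (LinearMap.ker g).subtype g ∧ Function.Surjective g := by
  obtain ⟨n, g, hg⟩ := Module.Finite.exists_fin' R M
  exact ⟨n, g, Subtype.val_injective, g.exact_subtype_ker_map, hg⟩

end ProjectiveDimension

/-! ### Split injections over local rings, in particular of depth zero. -/

section LocalSplitting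

variable {R : Type u} [CommRing R] [IsLocalRing R] {K F : Type u} [AddCommGroup K]
  [AddCommGroup F] [Module R K] [Module R F] [Module.Finite R K] [Module.Finite R F]
  [Module.Free R F]

/-- A map to a finite free module over a local ring splits if it is injective modulo the maximal
ideal. -/
lemma exists_retraction_of_mem_maximalIdeal_smul {i : K →ₗ[R] F}
    (h : ∀ v, i v ∈ maximalIdeal R • (⊤ : Submodule R F) →
      v ∈ maximalIdeal R • (⊤ : Submodule R K)) : ∃ l, l ∘ₗ i = LinearMap.id := by
  rw [IsLocalRing.split_injective_iff_lTensor_residueField_injective,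
    injective_iff_map_eq_zero]
  intro z hz
  obtain ⟨v, rfl⟩ := TensorProduct.mk_surjective R K (ResidueField R)
    Ideal.Quotient.mk_surjective z
  have key (E : Type u) [AddCommGroup E] [Module R E] (w : E) :
      (1 : ResidueField R) ⊗ₜ[R] w = 0 ↔ w ∈ maximalIdeal R • (⊤ : Submodule R E) := by
    rw [← Submodule.Quotient.mk_eq_zero,
      ← TensorProduct.quotTensorEquivQuotSMul_mk_one_tmul (maximalIdeal R) w]
    exact (LinearEquiv.map_eq_zero_iff _).symm
  exact (key K v).mpr (h v ((key F (i v)).mp hz))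

/-- A coordinate of v outside the maximal ideal would be a unit, and s ≠ 0 cannot kill a unit. -/
lemma mem_maximalIdeal_smul_of_smul_eq_zero [Module.Free R K] {s : R} (hs : s ≠ 0) {v : K}
    (h : s • v = 0) : v ∈ maximalIdeal R • (⊤ : Submodule R K) := by
  let b := Module.Free.chooseBasis R K
  rw [← b.sum_repr v]
  refine Submodule.sum_mem _ fun j _ ↦ Submodule.smul_mem_smul ?_ trivial
  by_contra hj
  have hu : IsUnit (b.repr v j) := by simpa using hj
  have h0 : s * b.repr v j = 0 := by
    have := congr(b.repr $h j)
    simpa using this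
  exact hs ((hu.mul_left_eq_zero).mp h0)

/-- Over a local ring whose maximal ideal is annihilated by a nonzero element, injections of finite
free modules split. -/
lemma exists_retraction_of_annihilator_maximalIdeal [Module.Free R K] {s : R} (hs : s ≠ 0)
    (hsm : ∀ r ∈ maximalIdeal R, s * r = 0) {i : K →ₗ[R] F} (hi : Function.Injective i) :
    ∃ l, l ∘ₗ i = LinearMap.id := by
  -- If i v lies in the maximal ideal times F, then s kills i v, hence v by injectivity.
  refine exists_retraction_of_mem_maximalIdeal_smul fun v hv ↦
    mem_maximalIdeal_smul_of_smul_eq_zero hs (hi ?_)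
  rw [map_smul, map_zero]
  generalize i v = w at hv
  induction hv using Submodule.smul_induction_on' with
  | smul r hr n _ => rw [smul_smul, hsm r hr, zero_smul]
  | add x _ y _ hx hy => rw [smul_add, hx, hy, add_zero]

/-- Over a local ring whose maximal ideal is annihilated by a nonzero element, a module with a
resolution of length one by finite projective modules is projective. -/
lemma projective_of_annihilator_maximalIdeal {R K F M : Type u} [CommRing R] [IsLocalRing R]
    [AddCommGroup K] [AddCommGroup F] [AddCommGroup M] [Module R K] [Module R F] [Module R M]
    [Module.Finite R K] [Module.Finite R F] [Module.Projective R K] [Module.Projective R F]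
    {s : R} (hs : s ≠ 0) (hsm : ∀ r ∈ maximalIdeal R, s * r = 0) {f : K →ₗ[R] F} {g : F →ₗ[R] M}
    (hf : Function.Injective f) (h : Function.Exact f g) (hg : Function.Surjective g) :
    Module.Projective R M := by
  have : Module.Free R K := Module.free_of_flat_of_isLocalRing
  have : Module.Free R F := Module.free_of_flat_of_isLocalRing
  exact h.projective_of_retraction hf hg (exists_retraction_of_annihilator_maximalIdeal hs hsm hf)

end LocalSplitting

/-! ### Modules of finite projective dimension at minimal primes. -/

section MinimalPrime

variable {R : Type u} [CommRing R] [IsNoetherianRing R] {P : Ideal R} [P.IsPrime]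

/-- The maximal ideal is the only prime of R_P, so it is the associated prime that R_P must have,
that is, the annihilator of some nonzero s. -/
lemma exists_annihilator_maximalIdeal_localization (hP : P ∈ minimalPrimes R) :
    ∃ s : Localization.AtPrime P, s ≠ 0 ∧ ∀ r ∈ maximalIdeal (Localization.AtPrime P), s * r = 0 := by
  let S := Localization.AtPrime P
  have : IsNoetherianRing S := IsLocalization.isNoetherianRing P.primeCompl S inferInstance
  obtain ⟨Q, hQ⟩ := associatedPrimes.nonempty S S
  have hQp : Q.IsPrime := hQ.isPrime
  have hle : Q ≤ maximalIdeal S := le_maximalIdeal hQp.ne_top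
  have hmax : (maximalIdeal S).under R = P := IsLocalization.AtPrime.under_maximalIdeal S P
  have hunder : Q.under R = P := by
    have h1 : Q.under R ≤ P := (Ideal.comap_mono hle).trans hmax.le
    exact le_antisymm h1 (hP.2 ⟨Ideal.comap_isPrime _ _, bot_le⟩ h1)
  have heq : Q = maximalIdeal S := by
    rw [← IsLocalization.map_under P.primeCompl S Q, hunder]
    conv_rhs => rw [← IsLocalization.map_under P.primeCompl S (maximalIdeal S), hmax]
  obtain ⟨-, s, hs⟩ := isAssociatedPrime_iff.mp hQ
  refine ⟨s, ?_, fun r hr ↦ ?_⟩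
  · rintro rfl
    exact hQp.ne_top (by rw [hs]; simp)
  · rw [← heq, hs, Submodule.mem_colon_singleton, Submodule.mem_bot, smul_eq_mul] at hr
    rw [mul_comm, hr]

/-- A finite module of finite projective dimension is free at the minimal primes. -/
lemma projective_localizedModule_of_mem_minimalPrimes (hP : P ∈ minimalPrimes R) (n : ℕ)
    (M : Type u) [AddCommGroup M] [Module R M] [Module.Finite R M]
    (hM : HasProjectiveDimensionLE (ModuleCat.of R M) n) :
    Module.Projective (Localization.AtPrime P) (LocalizedModule P.primeCompl M) := by
  induction n generalizing M with
  | zero =>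
    have := hasProjectiveDimensionLE_zero_iff.mp hM
    infer_instance
  | succ n ih =>
    obtain ⟨m, g, hf, h, hg⟩ := exists_exact_finite_free R M
    have hK := ih _ ((hasProjectiveDimensionLE_succ_iff hf h hg n).mp hM)
    -- The syzygy is projective at P by induction, so M_P has a resolution of length one over a ring
    -- of depth zero, and this splits.
    obtain ⟨s, hs, hsm⟩ := exists_annihilator_maximalIdeal_localization hP
    let i := LocalizedModule.map P.primeCompl (LinearMap.ker g).subtype
    let p := LocalizedModule.map P.primeCompl g
    have hinj : Function.Injective i := LocalizedModule.map_injective P.primeCompl _ hf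
    have hsurj : Function.Surjective p := LocalizedModule.map_surjective P.primeCompl _ hg
    have hex : Function.Exact i p := LocalizedModule.map_exact P.primeCompl _ _ h
    exact projective_of_annihilator_maximalIdeal (R := Localization.AtPrime P)
      (K := LocalizedModule P.primeCompl (LinearMap.ker g))
      (F := LocalizedModule P.primeCompl (Fin m → R)) (M := LocalizedModule P.primeCompl M)
      (f := i) (g := p) hs hsm hinj hex hsurj

lemma exists_retraction_up_to_smul (hP : P ∈ minimalPrimes R) (n : ℕ) {K F M : Type u}
    [AddCommGroup K] [AddCommGroup F] [AddCommGroup M] [Module R K] [Module R F] [Module R M]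
    [Module.Finite R F] {f : K →ₗ[R] F} {g : F →ₗ[R] M}
    (hf : Function.Injective f) (h : Function.Exact f g) (hg : Function.Surjective g)
    (hM : HasProjectiveDimensionLE (ModuleCat.of R M) n) :
    ∃ (π : F →ₗ[R] K) (s : R), s ∉ P ∧ π ∘ₗ f = s • LinearMap.id := by
  have : Module.Finite R M := .of_surjective g hg
  have : Module.Finite R K := .of_injective f hf
  have := Module.finitePresentation_of_finite R F
  have := projective_localizedModule_of_mem_minimalPrimes hP n M hM
  obtain ⟨l, hl⟩ := Function.Exact.exists_retraction_of_projective
    (f := LocalizedModule.map P.primeCompl f) (g := LocalizedModule.map P.primeCompl g)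
    (LocalizedModule.map_exact P.primeCompl _ _ h) (LocalizedModule.map_injective _ _ hf)
    (LocalizedModule.map_surjective _ _ hg)
  obtain ⟨π, s, hπ⟩ := Module.FinitePresentation.exists_lift_of_isLocalizedModule P.primeCompl
    (LocalizedModule.mkLinearMap P.primeCompl K)
    (l.restrictScalars R ∘ₗ LocalizedModule.mkLinearMap P.primeCompl F)
  -- π ∘ f and multiplication by s agree only after localization; the factor t makes them agree over
  -- R.
  obtain ⟨t, ht⟩ := Module.Finite.exists_smul_of_comp_eq_of_isLocalizedModule P.primeCompl
    (LocalizedModule.mkLinearMap P.primeCompl K) (π ∘ₗ f) (s • LinearMap.id) (by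
      rw [← LinearMap.comp_assoc, hπ]
      ext k
      have := LinearMap.congr_fun hl (LocalizedModule.mkLinearMap P.primeCompl K k)
      simp only [LinearMap.comp_apply, LinearMap.id_apply, LinearMap.smul_apply,
        LocalizedModule.mkLinearMap_apply, LocalizedModule.map_mk,
        LinearMap.restrictScalars_apply, LocalizedModule.mkLinearMap_apply] at this ⊢
      rw [this, ← LocalizedModule.mkLinearMap_apply, ← LocalizedModule.mkLinearMap_apply]
      exact ((LocalizedModule.mkLinearMap P.primeCompl K).map_smul (s : R) k).symm)
  refine ⟨(t : R) • π, t * s, (t * s).2, ?_⟩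
  rw [LinearMap.smul_comp, mul_smul]
  exact ht

end MinimalPrime

/-! ### Reduction modulo a regular element. -/

section BaseChange

variable {R : Type u} [CommRing R] (x : R)

lemma one_tmul_eq_zero_iff {E : Type u} [AddCommGroup E] [Module R E] (v : E) :
    (1 : R ⧸ Ideal.span {x}) ⊗ₜ[R] v = 0 ↔ ∃ w, x • w = v := by
  rw [← LinearEquiv.map_eq_zero_iff (TensorProduct.quotTensorEquivQuotSMul E (Ideal.span {x})),
    TensorProduct.quotTensorEquivQuotSMul_mk_one_tmul, Submodule.Quotient.mk_eq_zero,
    Submodule.ideal_span_singleton_smul, Submodule.mem_smul_pointwise_iff_exists]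
  simp

lemma exists_one_tmul_eq {E : Type u} [AddCommGroup E] [Module R E]
    (z : (R ⧸ Ideal.span {x}) ⊗[R] E) : ∃ v : E, 1 ⊗ₜ v = z :=
  TensorProduct.mk_surjective R E _ Ideal.Quotient.mk_surjective z

variable {x} {A B C : Type u} [AddCommGroup A] [AddCommGroup B] [AddCommGroup C] [Module R A]
  [Module R B] [Module R C] {f : A →ₗ[R] B} {g : B →ₗ[R] C}

/-- Regularity of x on C is what makes Tor₁(C, R/x) contribute nothing to the kernel. -/
lemma baseChange_quotient_injective (hf : Function.Injective f) (h : Function.Exact f g)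
    (hC : IsSMulRegular C x) : Function.Injective (f.baseChange (R ⧸ Ideal.span {x})) := by
  rw [injective_iff_map_eq_zero]
  intro z hz
  obtain ⟨a, rfl⟩ := exists_one_tmul_eq x z
  rw [LinearMap.baseChange_tmul, one_tmul_eq_zero_iff] at hz
  obtain ⟨b, hb⟩ := hz
  have hgb : g b = 0 := hC (by
    change x • g b = x • (0 : C)
    rw [← map_smul, hb, h.apply_apply_eq_zero, smul_zero])
  obtain ⟨a', rfl⟩ := (h b).mp hgb
  rw [one_tmul_eq_zero_iff]
  exact ⟨a', hf (by rw [map_smul, hb])⟩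

lemma IsSMulRegular.tensor_left {X : Type u} [AddCommGroup X] [Module R X]
    (hX : IsSMulRegular X x) (F : Type u) [AddCommGroup F] [Module R F] [Module.Flat R F] :
    IsSMulRegular (F ⊗[R] X) x := by
  rw [← RingTheory.Sequence.isWeaklyRegular_singleton_iff] at hX ⊢
  exact hX.isWeaklyRegular_lTensor

lemma IsSMulRegular.flat_module (hR : IsSMulRegular R x) (F : Type u) [AddCommGroup F] [Module R F]
    [Module.Flat R F] : IsSMulRegular F x := by
  have := hR.tensor_left F
  exact ((TensorProduct.rid R F).isSMulRegular_congr x).mp this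

/-- Reduction modulo an element that is regular on the ring and on the module preserves bounds for
the projective dimension. -/
lemma hasProjectiveDimensionLE_baseChange_quotient [IsNoetherianRing R] (hx : IsSMulRegular R x)
    (n : ℕ) (K : Type u) [AddCommGroup K] [Module R K] [Module.Finite R K]
    (hK : IsSMulRegular K x) (hpd : HasProjectiveDimensionLE (ModuleCat.of R K) n) :
    HasProjectiveDimensionLE (ModuleCat.of (R ⧸ Ideal.span {x})
      ((R ⧸ Ideal.span {x}) ⊗[R] K)) n := by
  induction n generalizing K with
  | zero =>
    have := hasProjectiveDimensionLE_zero_iff.mp hpd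
    rw [hasProjectiveDimensionLE_zero_iff]
    infer_instance
  | succ n ih =>
    obtain ⟨m, g, hf, h, hg⟩ := exists_exact_finite_free R K
    rw [hasProjectiveDimensionLE_succ_iff (baseChange_quotient_injective hf h hK)
      (g := g.baseChange (R ⧸ Ideal.span {x})) (lTensor_exact _ h hg)
      (LinearMap.lTensor_surjective _ hg)]
    -- The syzygy lies in a free module, so x is regular on it too.
    refine ih _ ?_ ((hasProjectiveDimensionLE_succ_iff hf h hg n).mp hpd)
    intro a b hab
    exact hf (hx.flat_module (Fin m → R) (by simpa using congrArg (LinearMap.ker g).subtype hab))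

/-- The injectivity hypothesis plays the role of Tor₁(C, X/xX) = 0. Lift z with xz = 0 to y in B ⊗
X: then xy comes from some k in A ⊗ X, injectivity modulo x gives k = xk', and cancelling x in B ⊗ X
shows that y comes from k', so z = 0. -/
lemma isSMulRegular_tensor_of_baseChange_injective {X : Type u} [AddCommGroup X] [Module R X]
    (hX : IsSMulRegular X x) [Module.Flat R B] (h : Function.Exact f g)
    (hg : Function.Surjective g)
    (hinj : Function.Injective ((f.baseChange (R ⧸ Ideal.span {x})).rTensor
      ((R ⧸ Ideal.span {x}) ⊗[R] X))) : IsSMulRegular (C ⊗[R] X) x := by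
  have hinj' : ∀ k : A ⊗[R] X, (∃ w, x • w = f.rTensor X k) → ∃ w, x • w = k := by
    intro k hk
    rw [← one_tmul_eq_zero_iff] at hk ⊢
    let e (E : Type u) [AddCommGroup E] [Module R E] :=
      TensorProduct.AlgebraTensorModule.distribBaseChange R (R ⧸ Ideal.span {x}) E X
    have comm : ∀ k : A ⊗[R] X, e B (1 ⊗ₜ f.rTensor X k) =
        (f.baseChange (R ⧸ Ideal.span {x})).rTensor _ (e A (1 ⊗ₜ k)) := by
      intro k
      induction k with
      | zero => simp
      | add a b ha hb => simp only [map_add, TensorProduct.tmul_add, ha, hb]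
      | tmul a v => simp [e]
    refine (e A).injective (hinj ?_)
    rw [← comm, hk, map_zero, map_zero, map_zero]
  intro z z' hzz
  rw [← sub_eq_zero]
  have hz : x • (z - z') = 0 := by rw [smul_sub, sub_eq_zero]; exact hzz
  obtain ⟨y, hy⟩ := LinearMap.rTensor_surjective X hg (z - z')
  obtain ⟨k, hk⟩ := ((rTensor_exact X h hg) (x • y)).mp (by rw [map_smul, hy, hz])
  obtain ⟨k', rfl⟩ := hinj' k ⟨y, hk.symm⟩
  rw [map_smul] at hk
  rw [← hy, ← hX.tensor_left B hk]
  exact (rTensor_exact X h hg).apply_apply_eq_zero k'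

end BaseChange

/-! ### Vanishing of Tor₁ for finite projective dimension. -/

section TorVanishing

open RingTheory.Sequence

variable {R : Type u} [CommRing R] [IsLocalRing R]

lemma DepthGE.baseChange_quotient [IsNoetherianRing R] {x : R} [IsLocalRing (R ⧸ Ideal.span {x})]
    {n : ℕ} (X : Type u) [AddCommGroup X] [Module R X] [Module.Finite R X]
    (hx : IsSMulRegular X x) (h : DepthGE R (n + 1) X) :
    DepthGE (R ⧸ Ideal.span {x}) n ((R ⧸ Ideal.span {x}) ⊗[R] X) := by
  obtain ⟨rs, hl, hm, hr⟩ := (h.quotSMulTop hx).of_linearEquiv (QuotSMulTop.equivQuotTensor x X)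
  have hloc : IsLocalHom (algebraMap R (R ⧸ Ideal.span {x})) :=
    IsLocalHom.of_surjective _ Ideal.Quotient.mk_surjective
  refine ⟨rs.map (algebraMap R _), by simpa using hl, ?_, ?_⟩
  · intro r hr
    obtain ⟨s, hs, rfl⟩ := List.mem_map.mp hr
    exact map_nonunit (algebraMap R (R ⧸ Ideal.span {x})) s (hm s hs)
  · rwa [isWeaklyRegular_map_algebraMap_iff]

/-- The zero divisors on X are the union of its associated primes, all minimal since X has depth d.
-/
lemma isSMulRegular_of_notMem_minimalPrimes [IsNoetherianRing R] {d : ℕ}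
    (hd : ringKrullDim R = d) (X : Type u) [AddCommGroup X] [Module R X] [Module.Finite R X]
    (hX : DepthGE R d X) {x : R} (hx : ∀ P ∈ minimalPrimes R, x ∉ P) : IsSMulRegular X x := by
  by_contra hcon
  have : x ∈ {r : R | IsSMulRegular X r}ᶜ := hcon
  rw [← biUnion_associatedPrimes_eq_compl_regular] at this
  obtain ⟨P, hP, hxP⟩ := Set.mem_iUnion₂.mp this
  exact hx P (hX.associatedPrimes_subset_minimalPrimes hd X hP) hxP

/-- The kernel of a syzygy inclusion tensored with a module is annihilated by an element avoiding all
minimal primes, if the projective dimension is finite. -/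
lemma exists_smul_ker_rTensor_eq_zero {R : Type u} [CommRing R] [IsNoetherianRing R]
    (X : Type u) [AddCommGroup X] [Module R X]
    {K F M : Type u} [AddCommGroup K] [AddCommGroup F] [AddCommGroup M] [Module R K]
    [Module R F] [Module R M] [Module.Finite R F]
    {f : K →ₗ[R] F} {g : F →ₗ[R] M} (hf : Function.Injective f) (h : Function.Exact f g)
    (hg : Function.Surjective g) (n : ℕ) (hM : HasProjectiveDimensionLE (ModuleCat.of R M) n) :
    ∃ x : R, (∀ P ∈ minimalPrimes R, x ∉ P) ∧ ∀ t, f.rTensor X t = 0 → x • t = 0 := by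
  let I : Ideal R := (LinearMap.ker (f.rTensor X)).annihilator
  have hI : ¬ ∃ P ∈ minimalPrimes R, I ≤ P := by
    rintro ⟨P, hP, hIP⟩
    have : P.IsPrime := hP.1.1
    obtain ⟨π, s, hs, hπ⟩ := exists_retraction_up_to_smul hP n hf h hg hM
    refine hs (hIP (Submodule.mem_annihilator.mpr fun t ht ↦ ?_))
    -- As π ∘ f is multiplication by s, anything killed by f ⊗ X is killed by s.
    have h1 : (π ∘ₗ f).rTensor X t = 0 := by
      rw [LinearMap.rTensor_comp_apply, LinearMap.mem_ker.mp ht, map_zero]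
    rwa [hπ, LinearMap.rTensor_smul, LinearMap.rTensor_id] at h1
  -- Prime avoidance over the finitely many minimal primes.
  obtain ⟨x, hxI, hx⟩ := Set.not_subset.mp (mt (Ideal.subset_union_prime_finite (f := id)
    (minimalPrimes.finite_of_isNoetherianRing R) ⊥ ⊥ (fun P hP _ _ ↦ hP.1.1)).mp hI)
  simp only [Set.mem_iUnion, not_exists] at hx
  exact ⟨x, hx, fun t ht ↦ Submodule.mem_annihilator.mp hxI t ht⟩

/-- Over a local ring `R` of maximal depth, syzygies of modules of finite projective dimension
remain submodules after tensoring with a module whose depth is the dimension of `R`. -/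
theorem rTensor_injective_of_hasProjectiveDimensionLE (d : ℕ) (R : Type u) [CommRing R]
    [IsLocalRing R] [IsNoetherianRing R] (hd : ringKrullDim R = d) (hR : DepthGE R d R)
    (X : Type u) [AddCommGroup X] [Module R X] [Module.Finite R X] (hX : DepthGE R d X)
    {K F M : Type u} [AddCommGroup K] [AddCommGroup F] [AddCommGroup M] [Module R K]
    [Module R F] [Module R M] [Module.Finite R F] [Module.Projective R F]
    {f : K →ₗ[R] F} {g : F →ₗ[R] M} (hf : Function.Injective f) (h : Function.Exact f g)
    (hg : Function.Surjective g) (n : ℕ) (hM : HasProjectiveDimensionLE (ModuleCat.of R M) n) :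
    Function.Injective (f.rTensor X) := by
  induction d generalizing R X K F M n with
  | zero =>
    obtain ⟨x, hx, hker⟩ := exists_smul_ker_rTensor_eq_zero X hf h hg n hM
    have hxR := isSMulRegular_of_notMem_minimalPrimes hd R hR hx
    -- In dimension zero a regular nonunit would lower the dimension below zero.
    have hu : IsUnit x := by
      by_contra hu
      have h1 := ringKrullDim_quotient_span_singleton_succ_eq_ringKrullDim hxR
        ((mem_maximalIdeal x).mpr hu)
      have : Nontrivial (R ⧸ Ideal.span {x}) :=
        Ideal.Quotient.nontrivial_iff.mpr (by rwa [Ne, Ideal.span_singleton_eq_top])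
      have h2 : 0 ≤ ringKrullDim (R ⧸ Ideal.span {x}) := ringKrullDim_nonneg_of_nontrivial
      have h3 : (1 : WithBot ℕ∞) ≤ ((0 : ℕ) : WithBot ℕ∞) := by
        rw [← hd, ← h1]; exact le_add_of_nonneg_left h2
      exact absurd h3 (by decide)
    rw [injective_iff_map_eq_zero]
    exact fun t ht ↦ hu.smul_left_cancel.mp (by rw [hker t ht, smul_zero])
  | succ d ih =>
    obtain ⟨x, hx, hker⟩ := exists_smul_ker_rTensor_eq_zero X hf h hg n hM
    rw [injective_iff_map_eq_zero]
    intro t ht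
    by_cases hu : IsUnit x
    · exact hu.smul_left_cancel.mp (by rw [hker t ht, smul_zero])
    have hxR := isSMulRegular_of_notMem_minimalPrimes hd R hR hx
    have hxX := isSMulRegular_of_notMem_minimalPrimes hd X hX hx
    have h1 := ringKrullDim_quotient_span_singleton_succ_eq_ringKrullDim hxR
      ((mem_maximalIdeal x).mpr hu)
    have : Nontrivial (R ⧸ Ideal.span {x}) :=
      Ideal.Quotient.nontrivial_iff.mpr (by rwa [Ne, Ideal.span_singleton_eq_top])
    have : IsLocalRing (R ⧸ Ideal.span {x}) :=
      .of_surjective' _ Ideal.Quotient.mk_surjective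
    have hd' : ringKrullDim (R ⧸ Ideal.span {x}) = d := by
      rw [hd, Nat.cast_add] at h1
      exact le_antisymm (ENat.WithBot.add_le_add_natCast_right_iff.mp h1.le)
        (ENat.WithBot.add_le_add_natCast_right_iff.mp h1.ge)
    have hR' : DepthGE (R ⧸ Ideal.span {x}) d (R ⧸ Ideal.span {x}) :=
      (hR.baseChange_quotient R hxR).of_linearEquiv
        (TensorProduct.AlgebraTensorModule.rid R (R ⧸ Ideal.span {x}) (R ⧸ Ideal.span {x}))
    have hX' := hX.baseChange_quotient X hxX
    have : Module.Finite R K := .of_injective f hf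
    -- The reduction is applied to K instead of M: x is regular on K ⊆ F but may fail to be so on M.
    have hxK : IsSMulRegular K x := fun a b hab ↦
      hf (hxR.flat_module F (by simpa using congrArg f hab))
    have hK : HasProjectiveDimensionLE (ModuleCat.of R K) n :=
      (hasProjectiveDimensionLE_succ_iff hf h hg n).mp
        (hasProjectiveDimensionLT_of_ge _ (n + 1) (n + 2) (by omega))
    obtain ⟨m, q, hi, hex, hq⟩ := exists_exact_finite_free R K
    -- The induction hypothesis over R/x, for a presentation of K/xK, makes x regular on K ⊗ X; the
    -- kernel of f ⊗ X is killed by x, hence zero.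
    have hreg : IsSMulRegular (K ⊗[R] X) x :=
      isSMulRegular_tensor_of_baseChange_injective hxX hex hq
        (ih (R ⧸ Ideal.span {x}) hd' hR' _ hX' (baseChange_quotient_injective hi hex hxK)
          (g := q.baseChange (R ⧸ Ideal.span {x})) (lTensor_exact _ hex hq)
          (LinearMap.lTensor_surjective _ hq) n
          (hasProjectiveDimensionLE_baseChange_quotient hxR n K hxK hK))
    exact hreg (by simpa using hker t ht)

end TorVanishing

/-! ### Freeness and depth of syzygies via Ext from the residue field. -/

section ExtResidueField

open Abelian

variable {R : Type u} [CommRing R] [IsLocalRing R]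

/-- The condition on C is vacuous for n = 0, where left exactness of Hom suffices. -/
lemma eq_zero_of_comp_mk₀_eq_zero {R A B C : Type u} [CommRing R] [AddCommGroup A]
    [AddCommGroup B] [AddCommGroup C] [Module R A] [Module R B] [Module R C]
    {f : A →ₗ[R] B} {g : B →ₗ[R] C} (hf : Function.Injective f) (h : Function.Exact f g)
    (hg : Function.Surjective g) (L : ModuleCat.{u} R) {n : ℕ}
    (hC : ∀ i, i + 1 = n → Subsingleton (Ext L (ModuleCat.of R C) i))
    (e : Ext L (ModuleCat.of R A) n)
    (he : e.comp (Ext.mk₀ (ModuleCat.ofHom f)) (add_zero n) = 0) : e = 0 := by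
  cases n with
  | zero =>
    have : Mono (ModuleCat.ofHom f) := (ModuleCat.mono_iff_injective _).mpr hf
    exact Ext.postcomp_mk₀_injective_of_mono L (ModuleCat.ofHom f)
      (he.trans (Ext.zero_comp L 0 (Ext.mk₀ (ModuleCat.ofHom f)) 0 (add_zero 0)).symm)
  | succ n =>
    obtain ⟨c, rfl⟩ := Ext.covariant_sequence_exact₁ L (h.moduleCatComplex_shortExact hf hg)
      (n₀ := n) e he rfl
    have := hC n rfl
    rw [Subsingleton.elim (α := Ext L (ModuleCat.of R C) n) c 0, Ext.zero_comp]

lemma smul_ext_residueField_eq_zero {Y : ModuleCat.{u} R} {n : ℕ} {r : R}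
    (hr : r ∈ maximalIdeal R) (e : Ext (ModuleCat.of R (ResidueField R)) Y n) : r • e = 0 := by
  have h0 : r • 𝟙 (ModuleCat.of R (ResidueField R)) = 0 := by
    ext z
    obtain ⟨s, rfl⟩ := IsLocalRing.residue_surjective z
    change r • residue R s = 0
    rw [Algebra.smul_def]
    change residue R r * residue R s = 0
    rw [(residue_eq_zero_iff r).mpr hr, zero_mul]
  rw [← Ext.mk₀_id_comp e, ← Ext.smul_comp, ← Ext.mk₀_smul, h0, Ext.mk₀_zero, Ext.zero_comp]

/-- The map y ↦ w ⊗ y is a sum of maps with coefficients in the maximal ideal, which acts as zero on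
Ext(k, -). -/
lemma ext_residueField_comp_mk_eq_zero {F X : Type u} [AddCommGroup F] [AddCommGroup X]
    [Module R F] [Module R X] {n : ℕ}
    (e : Ext (ModuleCat.of R (ResidueField R)) (ModuleCat.of R X) n) {w : F}
    (hw : w ∈ maximalIdeal R • (⊤ : Submodule R F)) :
    e.comp (Ext.mk₀ (ModuleCat.ofHom (TensorProduct.mk R F X w))) (add_zero n) = 0 := by
  induction hw using Submodule.smul_induction_on' with
  | smul r hr w _ =>
    have hsmul : ModuleCat.ofHom (TensorProduct.mk R F X (r • w)) =
        r • ModuleCat.ofHom (TensorProduct.mk R F X w) := by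
      rw [map_smul]; rfl
    rw [hsmul, Ext.mk₀_smul, Ext.comp_smul, ← Ext.smul_comp,
      smul_ext_residueField_eq_zero hr, Ext.zero_comp]
  | add v _ w _ hv hw =>
    have hadd : ModuleCat.ofHom (TensorProduct.mk R F X (v + w)) =
        ModuleCat.ofHom (TensorProduct.mk R F X v) + ModuleCat.ofHom (TensorProduct.mk R F X w) := by
      rw [map_add]; rfl
    rw [hadd, Ext.mk₀_add, Ext.comp_add, hv, hw, add_zero]

/-- A vector of a finite free module over a local ring is part of a basis unless it lies in the
multiple of the module by the maximal ideal. -/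
lemma exists_dual_eq_one {K : Type u} [AddCommGroup K] [Module R K] [Module.Finite R K]
    [Module.Free R K] {v : K} (hv : v ∉ maximalIdeal R • (⊤ : Submodule R K)) :
    ∃ φ : K →ₗ[R] R, φ v = 1 := by
  let b := Module.Free.chooseBasis R K
  obtain ⟨j, hj⟩ : ∃ j, b.repr v j ∉ maximalIdeal R := by
    by_contra! hcon
    refine hv ?_
    rw [← b.sum_repr v]
    exact Submodule.sum_mem _ fun j _ ↦ Submodule.smul_mem_smul (hcon j) trivial
  obtain ⟨c, hc⟩ := (show IsUnit (b.repr v j) by simpa using hj).exists_left_inv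
  exact ⟨c • b.coord j, by simpa using hc⟩

variable [IsNoetherianRing R]

/-- Without a splitting, some basis vector v of K has f v in the maximal ideal times F. Then
Ext^d(k, X) → Ext^d(k, K ⊗ X) → Ext^d(k, F ⊗ X) is zero by the choice of v. The first map, induced
by y ↦ v ⊗ y, is split injective, and the second is injective because Ext^(d-1)(k, M ⊗ X) = 0. So
Ext^d(k, X) = 0 and X ≠ 0 would have depth above dim R. -/
lemma exists_retraction_of_depthGE {d : ℕ} (hd : ringKrullDim R = d)
    (X : Type u) [AddCommGroup X] [Module R X] [Module.Finite R X] [Nontrivial X]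
    (hX : DepthGE R d X) {K F M : Type u} [AddCommGroup K] [AddCommGroup F] [AddCommGroup M]
    [Module R K] [Module R F] [Module R M] [Module.Finite R K] [Module.Free R K]
    [Module.Finite R F] [Module.Free R F] {f : K →ₗ[R] F} {g : F →ₗ[R] M}
    (hf : Function.Injective (f.rTensor X)) (h : Function.Exact f g) (hg : Function.Surjective g)
    (hMX : DepthGE R d (M ⊗[R] X)) : ∃ l, l ∘ₗ f = LinearMap.id := by
  have : Module.Finite R M := .of_surjective g hg
  have hex := rTensor_exact X h hg
  have hsurj := LinearMap.rTensor_surjective X hg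
  refine exists_retraction_of_mem_maximalIdeal_smul fun v hv ↦ ?_
  by_contra hvK
  obtain ⟨φ, hφ⟩ := exists_dual_eq_one hvK
  have hd1 : DepthGE R (d + 1) X := by
    rw [depthGE_iff_subsingleton_ext] at hX hMX ⊢
    intro j hj
    rcases Nat.lt_succ_iff_lt_or_eq.mp hj with hj | rfl
    · exact hX j hj
    refine subsingleton_of_forall_eq 0 fun e ↦ ?_
    have hcomp : ModuleCat.ofHom (TensorProduct.mk R K X v) ≫ ModuleCat.ofHom (f.rTensor X) =
        ModuleCat.ofHom (TensorProduct.mk R F X (f v)) := rfl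
    have h0 : (e.comp (Ext.mk₀ (ModuleCat.ofHom (TensorProduct.mk R K X v))) (add_zero j)).comp
        (Ext.mk₀ (ModuleCat.ofHom (f.rTensor X))) (add_zero j) = 0 := by
      rw [Ext.comp_assoc_of_third_deg_zero, Ext.mk₀_comp_mk₀, hcomp]
      exact ext_residueField_comp_mk_eq_zero e hv
    have h1 := eq_zero_of_comp_mk₀_eq_zero hf hex hsurj _ (fun i hi ↦ hMX i (by omega)) _ h0
    have hid : ModuleCat.ofHom (TensorProduct.mk R K X v) ≫
        ModuleCat.ofHom ((TensorProduct.lid R X).toLinearMap ∘ₗ φ.rTensor X) =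
          𝟙 (ModuleCat.of R X) := by
      ext y
      simp [hφ]
    rw [← Ext.comp_mk₀_id e, ← hid, ← Ext.mk₀_comp_mk₀, ← Ext.comp_assoc_of_third_deg_zero, h1,
      Ext.zero_comp]
  have h2 := hd1.le_ringKrullDim X
  rw [hd] at h2
  have h3 : d + 1 ≤ d := by exact_mod_cast h2
  omega

/-- A finite module `M` of finite projective dimension is free if `M ⊗ X` has maximal depth. -/
theorem free_of_depthGE_tensor {d : ℕ} (hd : ringKrullDim R = d) (hR : DepthGE R d R)
    (X : Type u) [AddCommGroup X] [Module R X] [Module.Finite R X] [Nontrivial X]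
    (hX : DepthGE R d X) (n : ℕ) (M : Type u) [AddCommGroup M] [Module R M] [Module.Finite R M]
    (hM : HasProjectiveDimensionLE (ModuleCat.of R M) n) (hMX : DepthGE R d (M ⊗[R] X)) :
    Module.Free R M := by
  induction n generalizing M with
  | zero =>
    have := hasProjectiveDimensionLE_zero_iff.mp hM
    exact Module.free_of_flat_of_isLocalRing
  | succ n ih =>
    obtain ⟨m, g, hf, h, hg⟩ := exists_exact_finite_free R M
    have hinj := rTensor_injective_of_hasProjectiveDimensionLE d R hd hR X hX hf h hg _ hM
    -- The depth lemma passes maximal depth to the syzygy, so the induction hypothesis makes the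
    -- syzygy free.
    have hKX : DepthGE R d (LinearMap.ker g ⊗[R] X) := by
      cases d with
      | zero => exact ⟨[], rfl, by simp, .nil R _⟩
      | succ d =>
        exact DepthGE.left_term hinj (rTensor_exact X h hg) (LinearMap.rTensor_surjective X hg)
          (hX.tensor_left _) (hMX.mono (by omega))
    have := ih _ ((hasProjectiveDimensionLE_succ_iff hf h hg n).mp hM) hKX
    have := h.projective_of_retraction hf hg (exists_retraction_of_depthGE hd X hX hinj h hg hMX)
    exact Module.free_of_flat_of_isLocalRing

/-- The depth of `Ω ⊗ X`, for a syzygy module `Ω` of a nonfree finite module `M` of finite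
projective dimension. -/
theorem moduleDepth_syzygy_tensor {d : ℕ} (hd : ringKrullDim R = d) (hR : DepthGE R d R)
    (X : Type u) [AddCommGroup X] [Module R X] [Module.Finite R X] [Nontrivial X]
    (hX : DepthGE R d X) {K F M : Type u} [AddCommGroup K] [AddCommGroup F] [AddCommGroup M]
    [Module R K] [Module R F] [Module R M] [Module.Finite R F] [Module.Projective R F]
    {f : K →ₗ[R] F} {g : F →ₗ[R] M} (hf : Function.Injective f) (h : Function.Exact f g)
    (hg : Function.Surjective g) (n : ℕ) (hM : HasProjectiveDimensionLE (ModuleCat.of R M) n)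
    (hfree : ¬ Module.Free R M) :
    moduleDepth R (K ⊗[R] X) = moduleDepth R (M ⊗[R] X) + 1 := by
  have : Module.Finite R M := .of_surjective g hg
  have : Module.Finite R K := .of_injective f hf
  have hinj := rTensor_injective_of_hasProjectiveDimensionLE d R hd hR X hX hf h hg _ hM
  have hex := rTensor_exact X h hg
  have hsurj := LinearMap.rTensor_surjective X hg
  have hFX : DepthGE R d (F ⊗[R] X) := hX.tensor_left F
  -- Below d, the depth of F ⊗ X does not interfere in the depth lemma.
  have hlt : moduleDepth R (M ⊗[R] X) < d := by
    rw [← not_le, natCast_le_moduleDepth_iff]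
    exact fun hMX ↦ hfree (free_of_depthGE_tensor hd hR X hX n M hM hMX)
  obtain ⟨e, he⟩ := ENat.ne_top_iff_exists.mp hlt.ne_top
  rw [← he] at hlt ⊢
  have hed : e < d := by exact_mod_cast hlt
  have hle : ((e + 1 : ℕ) : ℕ∞) ≤ moduleDepth R (K ⊗[R] X) :=
    natCast_le_moduleDepth_iff.mpr (DepthGE.left_term hinj hex hsurj (hFX.mono hed)
      (natCast_le_moduleDepth_iff.mp he.le))
  refine le_antisymm ?_ (by exact_mod_cast hle)
  by_contra! hgt
  -- One more regular element on K ⊗ X would push the depth of M ⊗ X above e.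
  have h2 : ((e + 1 + 1 : ℕ) : ℕ∞) ≤ moduleDepth R (K ⊗[R] X) := by
    push_cast
    exact Order.add_one_le_of_lt hgt
  have h3 : ((e + 1 : ℕ) : ℕ∞) ≤ moduleDepth R (M ⊗[R] X) :=
    natCast_le_moduleDepth_iff.mpr (DepthGE.right_term hinj hex hsurj (hFX.mono hed)
      (natCast_le_moduleDepth_iff.mp h2))
  rw [← he] at h3
  have : e + 1 ≤ e := by exact_mod_cast h3
  omega

end ExtResidueField

/-! ### Bass' theorem and the depth of the canonical dual. -/

section FiniteInjectiveDimension

open Abelian RingTheory.Sequence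

variable {R : Type u} [CommRing R]

lemma subsingleton_ext_of_projective (F : Type u) [AddCommGroup F] [Module R F]
    [Module.Projective R F] (Y : ModuleCat.{u} R) (n : ℕ) :
    Subsingleton (Ext (ModuleCat.of R F) Y (n + 1)) := by
  have : Projective (ModuleCat.of R F) := (IsProjective.iff_projective F).mp inferInstance
  exact Ext.subsingleton_of_projective _ _ n

lemma subsingleton_ext_of_subsingleton (L : Type u) [AddCommGroup L] [Module R L] [Subsingleton L]
    (Y : ModuleCat.{u} R) (n : ℕ) : Subsingleton (Ext (ModuleCat.of R L) Y n) := by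
  refine subsingleton_of_forall_eq 0 fun e ↦ ?_
  have : Limits.IsZero (ModuleCat.of R L) := ModuleCat.isZero_of_subsingleton _
  rw [← e.mk₀_id_comp, this.eq_of_src (𝟙 _) 0, Ext.mk₀_zero, Ext.zero_comp]

/-- Each regular element raises by at most one the degree beyond which Ext vanishes. -/
lemma subsingleton_ext_quotient_of_isWeaklyRegular (L : Type u) [AddCommGroup L] [Module R L]
    (Y : ModuleCat.{u} R) (rs : List R) (hrs : IsWeaklyRegular L rs) (c : ℕ)
    (hL : ∀ i, c < i → Subsingleton (Ext (ModuleCat.of R L) Y i)) :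
    ∀ i, c + rs.length < i →
      Subsingleton (Ext (ModuleCat.of R (L ⧸ (Ideal.ofList rs • ⊤ : Submodule R L))) Y i) := by
  induction rs generalizing L c with
  | nil =>
    intro i hi
    have hbot : (Ideal.ofList ([] : List R) • ⊤ : Submodule R L) = ⊥ := by simp
    exact subsingleton_ext_from_linearEquiv (Submodule.quotEquivOfEqBot _ hbot).symm Y i (hL i hi)
  | cons x rs ih =>
    rw [isWeaklyRegular_cons_iff] at hrs
    intro i hi
    refine subsingleton_ext_from_linearEquiv
      (Submodule.quotOfListConsSMulTopEquivQuotSMulTopInner L x rs).symm Y i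
      (ih (QuotSMulTop x L) hrs.2 (c + 1) (fun j hj ↦ ?_) i (by simp at hi; omega))
    obtain ⟨j, rfl⟩ := Nat.exists_eq_add_of_lt (Nat.zero_lt_of_lt hj)
    rw [zero_add] at hj ⊢
    exact subsingleton_ext_from_right_term (f := LinearMap.lsmul R L x)
      (g := (x • (⊤ : Submodule R L)).mkQ) hrs.1 (LinearMap.exact_lsmul_mkQ_smul_top L x)
      (Submodule.mkQ_surjective _) Y j (hL j (by omega)) (hL (j + 1) (by omega))

variable [IsLocalRing R] [IsNoetherianRing R]

/-- A nonzero map from the simple module k is injective; if Hom(k, L) = 0, the maximal ideal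
contains an L-regular element. -/
lemma exists_injective_residueField_or_isSMulRegular (L : Type u) [AddCommGroup L] [Module R L]
    [Module.Finite R L] : (∃ f : ResidueField R →ₗ[R] L, Function.Injective f) ∨
      ∃ x ∈ maximalIdeal R, IsSMulRegular L x := by
  have hann : Module.annihilator R (ResidueField R) = maximalIdeal R :=
    Ideal.annihilator_quotient
  by_cases h : Subsingleton (ResidueField R →ₗ[R] L)
  · obtain ⟨x, hx, hreg⟩ := IsSMulRegular.subsingleton_linearMap_iff.mp h
    exact .inr ⟨x, hann ▸ hx, hreg⟩
  · left
    rw [not_subsingleton_iff_nontrivial] at h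
    obtain ⟨f, hf⟩ := exists_ne (0 : ResidueField R →ₗ[R] L)
    have : IsSimpleModule R (ResidueField R) :=
      isSimpleModule_iff_quot_maximal.mpr ⟨maximalIdeal R, inferInstance, ⟨.refl R _⟩⟩
    exact ⟨f, (LinearMap.injective_or_eq_zero f).resolve_right hf⟩

/-- Bass' theorem: the injective dimension of a finite module is bounded by the depth of the ring,
if it is finite. -/
theorem subsingleton_ext_of_hasInjectiveDimensionLT {d : ℕ} (hR : DepthGE R d R)
    (hR' : ¬ DepthGE R (d + 1) R) (Y : Type u) [AddCommGroup Y] [Module R Y] [Module.Finite R Y]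
    (m : ℕ) (hY : HasInjectiveDimensionLT (ModuleCat.of R Y) m) (i : ℕ) (hi : d < i)
    (L : Type u) [AddCommGroup L] [Module R L] [Module.Finite R L] :
    Subsingleton (Ext (ModuleCat.of R L) (ModuleCat.of R Y) i) := by
  obtain ⟨rs, hl, hm, hr⟩ := hR
  have hQ := subsingleton_ext_quotient_of_isWeaklyRegular R (ModuleCat.of R Y) rs hr 0
    (fun i hi ↦ by
      obtain ⟨j, rfl⟩ := Nat.exists_eq_add_of_lt hi
      rw [zero_add]
      exact subsingleton_ext_of_projective R _ j)
  -- The sequence `rs` has maximal length, so it cannot be extended, and k embeds in R/(rs), whose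
  -- Ext into Y vanishes above degree d.
  obtain ⟨s, hs⟩ : ∃ s : ResidueField R →ₗ[R] (R ⧸ (Ideal.ofList rs • ⊤ : Submodule R R)),
      Function.Injective s := by
    refine (exists_injective_residueField_or_isSMulRegular _).resolve_right ?_
    rintro ⟨x, hx, hreg⟩
    refine hR' ⟨rs ++ [x], by simp [hl], ?_, ?_⟩
    · simp only [List.mem_append, List.mem_singleton]
      rintro r (hr | rfl)
      exacts [hm r hr, hx]
    · rw [isWeaklyRegular_append_iff, isWeaklyRegular_singleton_iff]
      exact ⟨hr, hreg⟩
  -- Descending induction on the degree, from m on, where all Ext into Y vanish; inside it,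
  -- dévissage to L = R/p.
  obtain ⟨j, hj⟩ : ∃ j, m ≤ i + j := ⟨m, by omega⟩
  induction j generalizing i L with
  | zero => exact hY.subsingleton _ _ i hj _
  | succ j ih =>
    have ih' := ih (i + 1) (by omega)
    induction ‹Module.Finite R L› using
      IsNoetherianRing.induction_on_isQuotientEquivQuotientPrime R with
    | subsingleton N => exact subsingleton_ext_of_subsingleton N _ i
    | exact N₁ N₂ N₃ f g hf hg hfg h₁ h₃ =>
      exact subsingleton_ext_from_middle_term hf hfg hg _ i h₁ h₃
    | quotient N p e =>
      by_cases hp : p.1 = maximalIdeal R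
      -- For L = k, use 0 → k → R/(rs) → C → 0: Ext^i of the middle and Ext^(i+1) of C vanish.
      · have e' : ResidueField R ≃ₗ[R] N :=
          (Submodule.quotEquivOfEq _ _ hp.symm).trans e.symm
        refine subsingleton_ext_from_linearEquiv e' _ i ?_
        exact subsingleton_ext_from_left_term hs (LinearMap.exact_map_mkQ_range s)
          (Submodule.mkQ_surjective _) _ i (hQ i (by omega)) (ih' _ (by omega))
      -- For p not maximal, x in the maximal ideal outside p is regular on R/p, and Nakayama lowers
      -- the degree.
      · obtain ⟨x, hxm, hxp⟩ := Set.not_subset.mp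
          (fun h ↦ hp ((le_maximalIdeal p.2.ne_top).antisymm h))
        refine subsingleton_ext_of_quotSMulTop N Y hxm ?_ i (ih' _ (by omega))
        refine (e.isSMulRegular_congr x).mpr ?_
        rw [isSMulRegular_iff_right_eq_zero_of_smul]
        intro y hy
        obtain ⟨y, rfl⟩ := Ideal.Quotient.mk_surjective y
        rw [← Ideal.Quotient.mk_eq_mk, ← Submodule.Quotient.mk_smul, Ideal.Quotient.mk_eq_mk,
          Ideal.Quotient.eq_zero_iff_mem, smul_eq_mul] at hy
        rw [Ideal.Quotient.eq_zero_iff_mem]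
        exact (p.2.mem_or_mem hy).resolve_left hxp

/-- Each regular element on L lowers the vanishing degree by one. For depth d this leaves vanishing
in all positive degrees. -/
lemma subsingleton_ext_of_depthGE {d : ℕ} (Y : Type u) [AddCommGroup Y] [Module R Y]
    [Module.Finite R Y]
    (hY : ∀ i, d < i → ∀ (L : Type u) [AddCommGroup L] [Module R L] [Module.Finite R L],
      Subsingleton (Ext (ModuleCat.of R L) (ModuleCat.of R Y) i))
    (n i : ℕ) (hni : d < n + i) (L : Type u) [AddCommGroup L] [Module R L] [Module.Finite R L]
    (hL : DepthGE R n L) : Subsingleton (Ext (ModuleCat.of R L) (ModuleCat.of R Y) i) := by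
  induction n generalizing i L with
  | zero => exact hY i (by omega) L
  | succ n ih =>
    obtain ⟨rs, hl, hm, hr⟩ := hL
    obtain ⟨x, rs, rfl⟩ := List.exists_cons_of_length_eq_add_one hl
    rw [isWeaklyRegular_cons_iff] at hr
    exact subsingleton_ext_of_quotSMulTop L Y (hm x (by simp)) hr.1 i
      (ih (i + 1) (by omega) (QuotSMulTop x L)
        ⟨rs, by simpa using hl, fun r hr ↦ hm r (by simp [hr]), hr.2⟩)

omit [IsLocalRing R] [IsNoetherianRing R] in
lemma lcomp_surjective_of_subsingleton_ext (Y : Type u) [AddCommGroup Y] [Module R Y]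
    {A B C : Type u} [AddCommGroup A] [AddCommGroup B] [AddCommGroup C] [Module R A] [Module R B]
    [Module R C] {f : A →ₗ[R] B} {g : B →ₗ[R] C} (hf : Function.Injective f)
    (h : Function.Exact f g) (hg : Function.Surjective g)
    (hC : Subsingleton (Ext (ModuleCat.of R C) (ModuleCat.of R Y) 1)) :
    Function.Surjective (LinearMap.lcomp R Y f) := by
  intro a
  obtain ⟨b, hb⟩ := Ext.contravariant_sequence_exact₁ (h.moduleCatComplex_shortExact hf hg)
    (ModuleCat.of R Y) (n₁ := 1) (Ext.mk₀ (ModuleCat.ofHom a)) (add_comm 1 0)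
    (Subsingleton.elim (α := Ext (ModuleCat.of R C) (ModuleCat.of R Y) 1) _ _)
  obtain ⟨b, rfl⟩ := (Ext.mk₀_bijective _ _).2 b
  rw [Ext.mk₀_comp_mk₀] at hb
  have := (Ext.mk₀_bijective _ _).1 hb
  exact ⟨b.hom, congrArg ModuleCat.Hom.hom this⟩

/-- The module `Hom(N, Y)` is as deep as `Y` if the modules `Ext^i(N, Y)` vanish for `i > 0`. -/
theorem DepthGE.linearMap (n : ℕ) (Y : Type u) [AddCommGroup Y] [Module R Y] [Module.Finite R Y]
    (hY : DepthGE R n Y) (N : Type u) [AddCommGroup N] [Module R N] [Module.Finite R N]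
    (hN : ∀ i, Subsingleton (Ext (ModuleCat.of R N) (ModuleCat.of R Y) (i + 1))) :
    DepthGE R n (N →ₗ[R] Y) := by
  induction n generalizing N with
  | zero => exact ⟨[], rfl, by simp, .nil R _⟩
  | succ n ih =>
    obtain ⟨m, g, hf, h, hg⟩ := exists_exact_finite_free R N
    -- The syzygy inherits the vanishing, so its dual has depth at least n. Since Ext¹(N, Y) = 0,
    -- the dualized presentation is short exact with middle term Y^m, and the depth lemma gains one.
    have hK := ih (hY.mono (by omega)) (LinearMap.ker g) fun i ↦
      subsingleton_ext_from_left_term hf h hg _ (i + 1)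
        (subsingleton_ext_of_projective (Fin m → R) _ i) (hN (i + 1))
    have e : (Fin m → R) ⊗[R] Y ≃ₗ[R] ((Fin m → R) →ₗ[R] Y) :=
      (TensorProduct.comm R _ _).trans ((TensorProduct.piScalarRight R R Y (Fin m)).trans
        ((Pi.basisFun R (Fin m)).constr R))
    refine DepthGE.left_term (f := LinearMap.lcomp R Y g)
      (g := LinearMap.lcomp R Y (LinearMap.ker g).subtype) ?_ ?_
      (lcomp_surjective_of_subsingleton_ext Y hf h hg (hN 0))
      ((hY.tensor_left (Fin m → R)).of_linearEquiv e) hK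
    · exact LinearMap.lcomp_injective_of_surjective g hg
    · exact LinearMap.exact_lcomp_of_exact_of_surjective _ h hg

end FiniteInjectiveDimension

/-! ### The theorem, together with the example in parentheses. -/

theorem mainTheorem7 (R : Type u) [CommRing R] [IsCohenMacaulayLocalRing R]
    (ω : Type u) [AddCommGroup ω] [Module R ω] (hω : IsCanonicalModule R ω)
    (M : Type u) [AddCommGroup M] [Module R M] [Module.Finite R M]
    (N : Type u) [AddCommGroup N] [Module R N] (hN : IsMaximalCohenMacaulay R N)
    (F : MinimalFreeResolution R M) :
    (IsMaximalCohenMacaulay R (M ⊗[R] CanonicalDual R ω N) →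
      moduleDepth R (F.firstSyzygy ⊗[R] CanonicalDual R ω N) ≠
        moduleDepth R (M ⊗[R] CanonicalDual R ω N) + 1) ∧
    (moduleDepth R (F.firstSyzygy ⊗[R] CanonicalDual R ω N) ≠
        moduleDepth R (M ⊗[R] CanonicalDual R ω N) + 1 →
      projectiveDimension (ModuleCat.of R M) < ⊤ → Module.Free R M) := by
  have := hω.isMaximalCohenMacaulay.finite
  have := hN.finite
  obtain ⟨d, hd⟩ : ∃ d : ℕ, moduleDepth R R = d := by
    have h : (moduleDepth R R : WithBot ℕ∞) < ⊤ := by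
      rw [IsCohenMacaulayLocalRing.depth_eq]; exact ringKrullDim_lt_top
    obtain ⟨d, hd⟩ := ENat.ne_top_iff_exists.mp (show moduleDepth R R ≠ ⊤ by
      rintro h'; rw [h'] at h; exact lt_irrefl _ h)
    exact ⟨d, hd.symm⟩
  have hdim : ringKrullDim R = d := by
    rw [← IsCohenMacaulayLocalRing.depth_eq, hd]; rfl
  have hdepth {L : Type u} [AddCommGroup L] [Module R L] (hL : IsMaximalCohenMacaulay R L) :
      moduleDepth R L = d :=
    WithBot.coe_injective (hL.depth_eq.trans hdim)
  have hR : DepthGE R d R := natCast_le_moduleDepth_iff.mp hd.ge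
  have hR' : ¬ DepthGE R (d + 1) R := by
    rw [← natCast_le_moduleDepth_iff, hd, Nat.cast_le]; omega
  constructor
  · intro hMX heq
    rw [hdepth hMX] at heq
    -- Depth d + 1 is impossible: a zero module has depth `⊤`, a nonzero one at most d.
    rcases subsingleton_or_nontrivial (F.firstSyzygy ⊗[R] CanonicalDual R ω N) with h | h
    · rw [moduleDepth_of_subsingleton] at heq
      exact absurd heq (ENat.natCast_ne_top (d + 1)).symm
    · have hge : DepthGE R (d + 1) (F.firstSyzygy ⊗[R] CanonicalDual R ω N) :=
        natCast_le_moduleDepth_iff.mp (by rw [heq]; rfl)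
      have hle := hge.le_ringKrullDim
      rw [hdim] at hle
      have : d + 1 ≤ d := by exact_mod_cast hle
      omega
  · intro hne hpd
    -- If the dual were zero, both tensor products would have depth `⊤`, and `⊤ = ⊤ + 1` contradicts
    -- `hne`.
    rcases subsingleton_or_nontrivial (CanonicalDual R ω N) with h | h
    · refine absurd ?_ hne
      rw [moduleDepth_of_subsingleton, moduleDepth_of_subsingleton]; rfl
    obtain ⟨m, hm⟩ := (injectiveDimension_ne_top_iff _).mp hω.injectiveDimension_lt_top.ne
    obtain ⟨n, hn⟩ := (projectiveDimension_ne_top_iff _).mp hpd.ne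
    have hbass := subsingleton_ext_of_hasInjectiveDimensionLT hR hR' ω (m + 1) hm
    have hX : DepthGE R d (CanonicalDual R ω N) :=
      DepthGE.linearMap d ω (natCast_le_moduleDepth_iff.mp
        (hdepth hω.isMaximalCohenMacaulay).ge) N fun i ↦
          subsingleton_ext_of_depthGE ω hbass d (i + 1) (by omega) N
            (natCast_le_moduleDepth_iff.mp (hdepth hN).ge)
    by_contra hfree
    refine hne (moduleDepth_syzygy_tensor hdim hR _ hX (f := F.firstSyzygy.subtype) (g := F.ε)
      Subtype.val_injective ?_ F.ε_surjective n hn hfree)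
    rw [LinearMap.exact_iff, F.exact_zero.linearMap_ker_eq, Submodule.range_subtype]
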